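/- **Theorem 3.** Let $G$ be a finite group acting linearly on $\mathbb{C}^n$. For $r\in\mathbb{N}$ let $\mathcal{O}^r_G$ be the (finite-dimensional complex vector) space of $r$-jets at $0$ of $G$-invariant holomorphic function germs $(\mathbb{C}^n,0)\to(\mathbb{C},0)$ with a critical point at the origin, and let $D^r_G$ be the group of $r$-jets of germs of $G$-equivariant biholomorphic maps $(\mathbb{C}^n,0)\to(\mathbb{C}^n,0)$, which acts on $\mathcal{O}^r_G$ by composition, $(j^rf)\cdot(j^r\varphi)=j^r(f\circ\varphi)$. A $G$-invariant holomorphic germ $f:(\mathbb{C}^n,0)\to(\mathbb{C},0)$ with a critical point at the origin is called *equivariantly simple* if there is an $N\in\mathbb{N}$ such that for all sufficiently large $r$ the jet $j^rf$ has a neighbourhood in $\mathcal{O}^r_G$ that intersects at most $N$ orbits of $D^r_G$; it is called *equivariantly stable* if for all sufficiently large $r$ the $D^r_G$-orbit of $j^rf$ is open in $\mathcal{O}^r_G$. Then an equivariantly simple germ exists for the given action of $G$ if and only if an equivariantly stable germ exists for this action. -/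

import Mathlib

open Filter Topology

namespace EquivariantSingularity

/-- The space of `r`-jets at the origin of maps `(ℂⁿ, 0) → F`: tuples of a value and of multilinear
maps of orders `1, …, r`, with the topology of a finite product of normed spaces. -/
abbrev Jet (n r : ℕ) (F : Type) [NormedAddCommGroup F] [NormedSpace ℂ F] : Type :=
  (k : Fin (r + 1)) → ContinuousMultilinearMap ℂ (fun _ : Fin (k : ℕ) => Fin n → ℂ) F

/-- The `r`-jet at the origin of a map: all its derivatives of order at most `r`. -/
noncomputable def jet {n : ℕ} {F : Type} [NormedAddCommGroup F] [NormedSpace ℂ F] (r : ℕ)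
    (f : (Fin n → ℂ) → F) : Jet n r F :=
  fun k => iteratedFDeriv ℂ (k : ℕ) f 0

/-- `f` represents a `G`-invariant holomorphic germ `(ℂⁿ, 0) → (ℂ, 0)` with a critical point at the
origin. -/
structure IsInvariantSingularity {G : Type*} [Group G] {n : ℕ}
    (ρ : Representation ℂ G (Fin n → ℂ)) (f : (Fin n → ℂ) → ℂ) : Prop where
  analyticAt : AnalyticAt ℂ f 0
  invariant : ∀ g : G, ∀ᶠ x in 𝓝 (0 : Fin n → ℂ), f (ρ g x) = f x
  map_zero : f 0 = 0
  critical : fderiv ℂ f 0 = 0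

/-- `φ` represents the germ of a `G`-equivariant biholomorphic map `(ℂⁿ, 0) → (ℂⁿ, 0)`. -/
structure IsEquivariantDiffeo {G : Type*} [Group G] {n : ℕ}
    (ρ : Representation ℂ G (Fin n → ℂ)) (φ : (Fin n → ℂ) → (Fin n → ℂ)) : Prop where
  analyticAt : AnalyticAt ℂ φ 0
  map_zero : φ 0 = 0
  equivariant : ∀ g : G, ∀ᶠ x in 𝓝 (0 : Fin n → ℂ), φ (ρ g x) = ρ g (φ x)
  exists_inverse : ∃ ψ : (Fin n → ℂ) → (Fin n → ℂ), AnalyticAt ℂ ψ 0 ∧ ψ 0 = 0 ∧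
    (∀ᶠ x in 𝓝 (0 : Fin n → ℂ), ψ (φ x) = x) ∧ (∀ᶠ x in 𝓝 (0 : Fin n → ℂ), φ (ψ x) = x)

section Lemmas

variable {G : Type*} [Group G] {n : ℕ} {ρ : Representation ℂ G (Fin n → ℂ)}

theorem tendsto_zero {F : Type} [NormedAddCommGroup F] [NormedSpace ℂ F]
    {φ : (Fin n → ℂ) → F} (h : AnalyticAt ℂ φ 0) (h0 : φ 0 = 0) :
    Tendsto φ (𝓝 0) (𝓝 0) := by
  simpa [h0] using h.continuousAt.tendsto

theorem rep_tendsto_zero (ρ : Representation ℂ G (Fin n → ℂ)) (g : G) :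
    Tendsto (ρ g) (𝓝 0) (𝓝 0) := by
  simpa using (LinearMap.continuous_of_finiteDimensional (ρ g)).tendsto 0

/-- The `r`-jet of a composition only depends on the `r`-jets of the two maps. -/
theorem jet_comp_congr {F : Type} [NormedAddCommGroup F] [NormedSpace ℂ F] [CompleteSpace F] (r : ℕ)
    {f f' : (Fin n → ℂ) → F} {φ φ' : (Fin n → ℂ) → (Fin n → ℂ)}
    (hf : AnalyticAt ℂ f 0) (hf' : AnalyticAt ℂ f' 0)
    (hφ : AnalyticAt ℂ φ 0) (hφ' : AnalyticAt ℂ φ' 0) (hφ0 : φ 0 = 0) (hφ0' : φ' 0 = 0)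
    (h : jet r f = jet r f') (h' : jet r φ = jet r φ') :
    jet r (f ∘ φ) = jet r (f' ∘ φ') := by
  have e : ∀ k ≤ r, iteratedFDeriv ℂ k f 0 = iteratedFDeriv ℂ k f' 0 := fun k hk =>
    congrFun h ⟨k, Nat.lt_succ_of_le hk⟩
  have e' : ∀ k ≤ r, iteratedFDeriv ℂ k φ 0 = iteratedFDeriv ℂ k φ' 0 := fun k hk =>
    congrFun h' ⟨k, Nat.lt_succ_of_le hk⟩
  funext k
  have hk : (k : ℕ) ≤ r := Nat.le_of_lt_succ k.2
  have c1 : ContDiffAt ℂ (k : ℕ) f (φ 0) := by rw [hφ0]; exact hf.contDiffAt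
  have c2 : ContDiffAt ℂ (k : ℕ) f' (φ' 0) := by rw [hφ0']; exact hf'.contDiffAt
  change iteratedFDeriv ℂ (k : ℕ) (f ∘ φ) 0 = iteratedFDeriv ℂ (k : ℕ) (f' ∘ φ') 0
  rw [iteratedFDeriv_comp c1 hφ.contDiffAt le_rfl, iteratedFDeriv_comp c2 hφ'.contDiffAt le_rfl,
    hφ0, hφ0']
  unfold FormalMultilinearSeries.taylorComp
  refine Finset.sum_congr rfl fun c _ => ?_
  ext1 v
  simp only [FormalMultilinearSeries.compAlongOrderedFinpartition_apply, ftaylorSeries,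
    OrderedFinpartition.applyOrderedFinpartition_apply]
  rw [e _ (c.length_le.trans hk)]
  congr 1
  funext m
  rw [e' _ ((c.partSize_le m).trans hk)]

theorem jet_congr {F : Type} [NormedAddCommGroup F] [NormedSpace ℂ F] (r : ℕ)
    {f f' : (Fin n → ℂ) → F} (h : ∀ᶠ x in 𝓝 0, f x = f' x) : jet r f = jet r f' := by
  funext k
  exact (EventuallyEq.iteratedFDeriv ℂ h (k : ℕ)).self_of_nhds

theorem IsEquivariantDiffeo.id : IsEquivariantDiffeo ρ id where
  analyticAt := analyticAt_id
  map_zero := rfl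
  equivariant _ := Eventually.of_forall fun _ => rfl
  exists_inverse := ⟨_root_.id, analyticAt_id, rfl, Eventually.of_forall fun _ => rfl,
    Eventually.of_forall fun _ => rfl⟩

theorem IsEquivariantDiffeo.comp {φ χ : (Fin n → ℂ) → (Fin n → ℂ)}
    (hφ : IsEquivariantDiffeo ρ φ) (hχ : IsEquivariantDiffeo ρ χ) :
    IsEquivariantDiffeo ρ (φ ∘ χ) where
  analyticAt := AnalyticAt.comp (by rw [hχ.map_zero]; exact hφ.analyticAt) hχ.analyticAt
  map_zero := by simp [hχ.map_zero, hφ.map_zero]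
  equivariant g := by
    filter_upwards [hχ.equivariant g,
      (tendsto_zero hχ.analyticAt hχ.map_zero).eventually (hφ.equivariant g)] with x h1 h2
    simp [h1, h2]
  exists_inverse := by
    obtain ⟨ψ, a, z, l, r⟩ := hφ.exists_inverse
    obtain ⟨ψ', a', z', l', r'⟩ := hχ.exists_inverse
    refine ⟨ψ' ∘ ψ, AnalyticAt.comp (by rw [z]; exact a') a, by simp [z, z'], ?_, ?_⟩
    · filter_upwards [l', (tendsto_zero hχ.analyticAt hχ.map_zero).eventually l] with x h1 h2
      simp [h1, h2]
    · filter_upwards [r, (tendsto_zero a z).eventually r'] with x h1 h2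
      simp [h1, h2]

theorem IsEquivariantDiffeo.exists_inv {φ : (Fin n → ℂ) → (Fin n → ℂ)}
    (hφ : IsEquivariantDiffeo ρ φ) : ∃ ψ, IsEquivariantDiffeo ρ ψ ∧
      (∀ᶠ x in 𝓝 (0 : Fin n → ℂ), ψ (φ x) = x) ∧ (∀ᶠ x in 𝓝 (0 : Fin n → ℂ), φ (ψ x) = x) := by
  obtain ⟨ψ, a, z, l, r⟩ := hφ.exists_inverse
  refine ⟨ψ, ⟨a, z, fun g => ?_, φ, hφ.analyticAt, hφ.map_zero, r, l⟩, l, r⟩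
  have t := tendsto_zero a z
  filter_upwards [r, t.eventually (hφ.equivariant g),
    ((rep_tendsto_zero ρ g).comp t).eventually l] with x h1 h2 h3
  have h4 : φ (ρ g (ψ x)) = ρ g x := by rw [h2, h1]
  rw [← h4]
  exact h3

theorem IsInvariantSingularity.comp {f : (Fin n → ℂ) → ℂ} {φ : (Fin n → ℂ) → (Fin n → ℂ)}
    (hf : IsInvariantSingularity ρ f) (hφ : IsEquivariantDiffeo ρ φ) :
    IsInvariantSingularity ρ (f ∘ φ) where
  analyticAt := AnalyticAt.comp (by rw [hφ.map_zero]; exact hf.analyticAt) hφ.analyticAt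
  invariant g := by
    filter_upwards [hφ.equivariant g,
      (tendsto_zero hφ.analyticAt hφ.map_zero).eventually (hf.invariant g)] with x h1 h2
    simp [h1, h2]
  map_zero := by simp [hφ.map_zero, hf.map_zero]
  critical := by
    rw [fderiv_comp (x := 0) (by rw [hφ.map_zero]; exact hf.analyticAt.differentiableAt)
      hφ.analyticAt.differentiableAt, hφ.map_zero, hf.critical, ContinuousLinearMap.zero_comp]

end Lemmas

section Definitions

variable {G : Type*} [Group G] {n : ℕ} (ρ : Representation ℂ G (Fin n → ℂ)) (r : ℕ)

/-- The monoid, under composition, of maps representing germs of equivariant biholomorphic maps. -/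
def diffeoMonoid : Submonoid (Function.End (Fin n → ℂ)) where
  carrier := {φ | IsEquivariantDiffeo ρ φ}
  one_mem' := IsEquivariantDiffeo.id
  mul_mem' h h' := IsEquivariantDiffeo.comp h h'

/-- Two equivariant biholomorphic maps are identified if they have the same `r`-jet. -/
def jetCon : Con (diffeoMonoid ρ) where
  r φ χ := jet r (φ.1 : (Fin n → ℂ) → (Fin n → ℂ)) = jet r (χ.1 : (Fin n → ℂ) → (Fin n → ℂ))
  iseqv := ⟨fun _ => rfl, Eq.symm, Eq.trans⟩
  mul' {w x y z} h h' := by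
    exact jet_comp_congr (f := w.1) (f' := x.1) (φ := y.1) (φ' := z.1) r w.2.analyticAt
      x.2.analyticAt y.2.analyticAt z.2.analyticAt y.2.map_zero z.2.map_zero h h'

/-- `D^r_G`: the `r`-jets of germs of `G`-equivariant biholomorphic maps `(ℂⁿ, 0) → (ℂⁿ, 0)`,
multiplied by composition. -/
def DiffeoJet : Type := (jetCon ρ r).Quotient

instance : Monoid (DiffeoJet ρ r) := inferInstanceAs (Monoid (jetCon ρ r).Quotient)

/-- The element of `D^r_G` represented by an equivariant biholomorphic map. -/
def DiffeoJet.mk (φ : (Fin n → ℂ) → (Fin n → ℂ)) (hφ : IsEquivariantDiffeo ρ φ) :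
    DiffeoJet ρ r :=
  Con.toQuotient (c := jetCon ρ r) ⟨φ, hφ⟩

theorem DiffeoJet.exists_mk (d : DiffeoJet ρ r) : ∃ φ hφ, d = DiffeoJet.mk ρ r φ hφ :=
  Con.induction_on (c := jetCon ρ r) d fun φ => ⟨φ.1, φ.2, rfl⟩

theorem DiffeoJet.mk_eq_mk {φ χ : (Fin n → ℂ) → (Fin n → ℂ)} (hφ : IsEquivariantDiffeo ρ φ)
    (hχ : IsEquivariantDiffeo ρ χ) :
    DiffeoJet.mk ρ r φ hφ = DiffeoJet.mk ρ r χ hχ ↔ jet r φ = jet r χ :=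
  Con.eq (jetCon ρ r)

theorem DiffeoJet.isUnit (d : DiffeoJet ρ r) : IsUnit d := by
  obtain ⟨φ, hφ, rfl⟩ := DiffeoJet.exists_mk ρ r d
  obtain ⟨ψ, hψ, l, m⟩ := hφ.exists_inv
  refine ⟨⟨DiffeoJet.mk ρ r φ hφ, DiffeoJet.mk ρ r ψ hψ, ?_, ?_⟩, rfl⟩
  · exact (DiffeoJet.mk_eq_mk ρ r (hφ.comp hψ) IsEquivariantDiffeo.id).2 (jet_congr r m)
  · exact (DiffeoJet.mk_eq_mk ρ r (hψ.comp hφ) IsEquivariantDiffeo.id).2 (jet_congr r l)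

noncomputable instance : Group (DiffeoJet ρ r) := groupOfIsUnit (DiffeoJet.isUnit ρ r)

/-- `O^r_G`: the space of `r`-jets of `G`-invariant germs `(ℂⁿ, 0) → (ℂ, 0)` with a critical point
at the origin, with the topology induced from the space of all `r`-jets. -/
abbrev SingularityJet : Type :=
  {j : Jet n r ℂ // ∃ f, IsInvariantSingularity ρ f ∧ jet r f = j}

/-- The `r`-jet of an invariant singularity, as a point of `O^r_G`. -/
noncomputable def SingularityJet.of {f : (Fin n → ℂ) → ℂ} (hf : IsInvariantSingularity ρ f) :
    SingularityJet ρ r :=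
  ⟨jet r f, f, hf, rfl⟩

/-- `D^r_G` acts on `O^r_G` from the right by `(j^r f) · (j^r φ) = j^r (f ∘ φ)`. -/
noncomputable instance : SMul (DiffeoJet ρ r)ᵐᵒᵖ (SingularityJet ρ r) where
  smul d j := Con.liftOn (c := jetCon ρ r) d.unop
    (fun φ => SingularityJet.of ρ r (j.2.choose_spec.1.comp φ.2))
    (fun φ χ h => Subtype.ext (jet_comp_congr r j.2.choose_spec.1.analyticAt
      j.2.choose_spec.1.analyticAt φ.2.analyticAt χ.2.analyticAt φ.2.map_zero χ.2.map_zero rfl h))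

theorem smul_of {f : (Fin n → ℂ) → ℂ} (hf : IsInvariantSingularity ρ f)
    {φ : (Fin n → ℂ) → (Fin n → ℂ)} (hφ : IsEquivariantDiffeo ρ φ) :
    MulOpposite.op (DiffeoJet.mk ρ r φ hφ) • SingularityJet.of ρ r hf =
      SingularityJet.of ρ r (hf.comp hφ) := by
  have h := (SingularityJet.of ρ r hf).2.choose_spec
  exact Subtype.ext (jet_comp_congr r h.1.analyticAt hf.analyticAt hφ.analyticAt
    hφ.analyticAt hφ.map_zero hφ.map_zero h.2 rfl)

noncomputable instance : MulAction (DiffeoJet ρ r)ᵐᵒᵖ (SingularityJet ρ r) where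
  one_smul := by
    rintro ⟨_, f, hf, rfl⟩
    exact smul_of ρ r hf IsEquivariantDiffeo.id
  mul_smul := by
    rintro ⟨a⟩ ⟨b⟩ ⟨_, f, hf, rfl⟩
    obtain ⟨φ, hφ, rfl⟩ := DiffeoJet.exists_mk ρ r a
    obtain ⟨χ, hχ, rfl⟩ := DiffeoJet.exists_mk ρ r b
    change MulOpposite.op (DiffeoJet.mk ρ r (χ ∘ φ) (hχ.comp hφ)) • SingularityJet.of ρ r hf =
      MulOpposite.op (DiffeoJet.mk ρ r φ hφ) •
        MulOpposite.op (DiffeoJet.mk ρ r χ hχ) • SingularityJet.of ρ r hf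
    rw [smul_of, smul_of, smul_of]

/-- The `D^r_G`-orbit of a point of `O^r_G`. -/
def jetOrbit (j : SingularityJet ρ r) : Set (SingularityJet ρ r) :=
  MulAction.orbit (DiffeoJet ρ r)ᵐᵒᵖ j

/-- An invariant singularity is equivariantly simple if there is a natural number `N` such that for
all sufficiently large `r` its `r`-jet has a neighbourhood in `O^r_G` which meets at most `N`
orbits of `D^r_G`. -/
def IsEquivariantlySimple (f : (Fin n → ℂ) → ℂ) : Prop :=
  ∃ hf : IsInvariantSingularity ρ f, ∃ N : ℕ, ∀ᶠ r : ℕ in atTop,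
    ∃ U ∈ 𝓝 (SingularityJet.of ρ r hf), (jetOrbit ρ r '' U).encard ≤ N

/-- An invariant singularity is equivariantly stable if for all sufficiently large `r` the
`D^r_G`-orbit of its `r`-jet is open in `O^r_G`. -/
def IsEquivariantlyStable (f : (Fin n → ℂ) → ℂ) : Prop :=
  ∃ hf : IsInvariantSingularity ρ f, ∀ᶠ r : ℕ in atTop,
    IsOpen (jetOrbit ρ r (SingularityJet.of ρ r hf))

end Definitions

end EquivariantSingularity

/-!
The orbit of a jet `j` is the image of the map `φ ↦ j ∘ φ`, whose rank is constant: it is the rank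
of the infinitesimal action of vector fields on `j`. If this action is onto, the orbit is open;
otherwise the Hausdorff dimension of the orbit is less than that of the whole space. Since a
neighbourhood of the jet of a simple germ is covered by finitely many orbits, the infinitesimal
action is onto at some jet, for every large `r`. As the infinitesimal action depends linearly on
`j`, the jets at which it is onto then form a dense open set. By Baire's theorem, applied in the
Banach space of invariant power series with bounded derivatives at the origin, a single germ has
such jets for all large `r` at once; it is stable. Conversely, an open orbit is a neighbourhood
which meets just one orbit.
-/

namespace EquivariantSingularity

section Surjective

theorem finite_setOf_not_surjective_add_smul {K V W : Type*} [Field K] [AddCommGroup V] [Module K V]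
    [AddCommGroup W] [Module K W] [FiniteDimensional K W] (A : V →ₗ[K] W) {B : V →ₗ[K] W}
    (hB : Function.Surjective B) : {t : K | ¬ Function.Surjective (A + t • B)}.Finite := by
  obtain ⟨s, hs⟩ := B.exists_rightInverse_of_surjective (LinearMap.range_eq_top.2 hB)
  refine (Module.End.finite_spectrum (-(A ∘ₗ s))).subset fun t ht hu => ht ?_
  have hcomp : (A + t • B) ∘ₗ s = algebraMap K (Module.End K W) t - -(A ∘ₗ s) := by
    rw [LinearMap.add_comp, LinearMap.smul_comp, hs, sub_neg_eq_add, add_comm,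
      Algebra.algebraMap_eq_smul_one, Module.End.one_eq_id]
  rw [spectrum.mem_resolventSet_iff, ← hcomp, Module.End.isUnit_iff] at hu
  exact .of_comp hu.surjective

variable {𝕜 V W X : Type*} [NontriviallyNormedField 𝕜] [NormedAddCommGroup V]
  [NormedSpace 𝕜 V] [NormedAddCommGroup W] [NormedSpace 𝕜 W] [FiniteDimensional 𝕜 W]
  [NormedAddCommGroup X] [NormedSpace 𝕜 X]

theorem dense_setOf_surjective (L : X →L[𝕜] V →L[𝕜] W) {x₀ : X}
    (hx₀ : Function.Surjective (L x₀)) : Dense {x | Function.Surjective (L x)} := by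
  intro x
  have hgood : {t : 𝕜 | Function.Surjective (L (x + t • x₀))} ∈ 𝓝[≠] (0 : 𝕜) := by
    have hfin := finite_setOf_not_surjective_add_smul (L x : V →ₗ[𝕜] W) hx₀
    filter_upwards [nhdsNE_le_cofinite _ hfin.compl_mem_cofinite] with t ht
    rw [map_add, map_smul]
    exact not_not.1 ht
  have htendsto : Tendsto (fun t : 𝕜 => x + t • x₀) (𝓝[≠] 0) (𝓝 x) := by
    have : Continuous fun t : 𝕜 => x + t • x₀ := by fun_prop
    simpa using (this.tendsto 0).mono_left nhdsWithin_le_nhds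
  exact mem_closure_of_tendsto htendsto hgood

variable [CompleteSpace 𝕜]

theorem isOpen_setOf_surjective : IsOpen {A : V →L[𝕜] W | Function.Surjective A} := by
  rw [isOpen_iff_mem_nhds]
  intro B hB
  obtain ⟨s, hs⟩ := B.exists_rightInverse_of_surjective (LinearMap.range_eq_top.2 hB)
  have : CompleteSpace W := FiniteDimensional.complete 𝕜 W
  have hcont : Continuous fun A : V →L[𝕜] W => A.comp s := by fun_prop
  have hunit : IsUnit (B.comp s) := hs ▸ isUnit_one
  filter_upwards [hcont.continuousAt.preimage_mem_nhds (Units.isOpen.mem_nhds hunit)] with A hA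
  exact .of_comp (ContinuousLinearMap.isUnit_iff_bijective.1 hA).surjective

theorem exists_forall_surjective [CompleteSpace X] {ι : Type*} [Countable ι] {V W : ι → Type*}
    [∀ i, NormedAddCommGroup (V i)] [∀ i, NormedSpace 𝕜 (V i)]
    [∀ i, NormedAddCommGroup (W i)] [∀ i, NormedSpace 𝕜 (W i)] [∀ i, FiniteDimensional 𝕜 (W i)]
    (L : ∀ i, X →L[𝕜] V i →L[𝕜] W i) (hL : ∀ i, ∃ x, Function.Surjective (L i x)) :
    ∃ x, ∀ i, Function.Surjective (L i x) := by
  have hdense : Dense (⋂ i, {x | Function.Surjective (L i x)}) :=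
    dense_iInter_of_isOpen (fun i => isOpen_setOf_surjective.preimage (L i).continuous)
      fun i => (hL i).elim fun _ => dense_setOf_surjective (L i)
  obtain ⟨x, hx⟩ := hdense.nonempty
  exact ⟨x, Set.mem_iInter.1 hx⟩

end Surjective

section ConstantRank

theorem comp_inr_eq_zero_of_comp_eq_fst {R V W M K : Type*} [Field R] [AddCommGroup V] [Module R V]
    [AddCommGroup W] [Module R W] [FiniteDimensional R W] [AddCommGroup M] [Module R M]
    [AddCommGroup K] [Module R K] {L : W →ₗ[R] M} {B : V →ₗ[R] W} {C : M × K →ₗ[R] V}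
    (hfst : L ∘ₗ B ∘ₗ C = .fst R M K)
    (hrank : Module.finrank R B.range = Module.finrank R M) :
    B ∘ₗ C ∘ₗ .inr R M K = 0 := by
  have hLB : ∀ y, L (B (C y)) = y.1 := LinearMap.congr_fun hfst
  have : FiniteDimensional R M := .of_surjective L fun m => ⟨_, hLB (m, 0)⟩
  have hsurj : Function.Surjective (L.domRestrict B.range) := fun m =>
    ⟨⟨B (C (m, 0)), C (m, 0), rfl⟩, hLB (m, 0)⟩
  rw [← LinearMap.injective_iff_surjective_of_finrank_eq_finrank hrank,
    LinearMap.injective_domRestrict_iff] at hsurj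
  ext z
  exact Submodule.disjoint_def.1 hsurj _ ⟨C (0, z), rfl⟩ (hLB (0, z))

variable {𝕜 E F M K : Type*} [RCLike 𝕜] [NormedAddCommGroup E] [NormedSpace 𝕜 E]
  [NormedAddCommGroup F] [NormedSpace 𝕜 F] [NormedAddCommGroup M] [NormedSpace 𝕜 M]
  [NormedAddCommGroup K] [NormedSpace 𝕜 K]

theorem eventually_eq_of_fderiv_comp_inr_eq_zero {h : M × K → F} {y₀ : M × K}
    (hh : ∀ᶠ y in 𝓝 y₀, DifferentiableAt 𝕜 h y)
    (hh' : ∀ᶠ y in 𝓝 y₀, fderiv 𝕜 h y ∘L .inr 𝕜 M K = 0) :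
    ∀ᶠ y in 𝓝 y₀, h y = h (y.1, y₀.2) := by
  let _ : NormedSpace ℝ K := .restrictScalars ℝ 𝕜 K
  obtain ⟨ε, hε, hball⟩ := Metric.eventually_nhds_iff_ball.1 (hh.and hh')
  filter_upwards [Metric.ball_mem_nhds y₀ hε] with ⟨a, b⟩ hab
  rw [← ball_prod_same, Set.mem_prod] at hab
  have hslice : ∀ z ∈ Metric.ball y₀.2 ε,
      HasFDerivAt (fun z => h (a, z)) (0 : K →L[𝕜] F) z := fun z hz => by
    obtain ⟨hdiff, hzero⟩ := hball (a, z) (ball_prod_same y₀.1 y₀.2 ε ▸ ⟨hab.1, hz⟩)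
    exact hzero ▸ hdiff.hasFDerivAt.comp z (hasFDerivAt_prodMk_right a z)
  exact Metric.isOpen_ball.is_const_of_fderiv_eq_zero (𝕜 := 𝕜) (convex_ball _ _).isPreconnected
    (fun z hz => (hslice z hz).differentiableAt.differentiableWithinAt)
    (fun z hz => (hslice z hz).fderiv) hab.2 (Metric.mem_ball_self hε)

theorem exists_chart_of_surjective_fderiv [CompleteSpace E] [FiniteDimensional 𝕜 M] {Q : E → M}
    {d : E} (hQ : ContDiffAt 𝕜 1 Q d) (hsurj : Function.Surjective (fderiv 𝕜 Q d)) :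
    ∃ (q : E →L[𝕜] (fderiv 𝕜 Q d).ker) (ψ : M × (fderiv 𝕜 Q d).ker → E),
      ContDiffAt 𝕜 1 ψ (Q d, q d) ∧ (∀ᶠ y in 𝓝 (Q d, q d), Q (ψ y) = y.1) ∧
      ψ (Q d, q d) = d ∧ ∀ᶠ v in 𝓝 d, ψ (Q v, q v) = v := by
  have : CompleteSpace M := FiniteDimensional.complete 𝕜 M
  have : CompleteSpace (fderiv 𝕜 Q d).ker := (fderiv 𝕜 Q d).isClosed_ker.completeSpace_coe
  obtain ⟨q, hq⟩ := (fderiv 𝕜 Q d).ker_closedComplemented_of_finiteDimensional_range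
  let e := (fderiv 𝕜 Q d).equivProdOfSurjectiveOfIsCompl q (LinearMap.range_eq_top.2 hsurj)
    (LinearMap.range_eq_of_proj hq) (LinearMap.isCompl_of_proj hq)
  have hΦ : ContDiffAt 𝕜 1 (fun v => (Q v, q v)) d := hQ.prodMk q.contDiff.contDiffAt
  have hΦ' : HasFDerivAt (fun v => (Q v, q v)) (e : E →L[𝕜] M × (fderiv 𝕜 Q d).ker) d :=
    (hQ.differentiableAt one_ne_zero).hasFDerivAt.prodMk q.hasFDerivAt
  let c := hΦ.toOpenPartialHomeomorph _ hΦ' one_ne_zero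
  have hd : d ∈ c.source := hΦ.mem_toOpenPartialHomeomorph_source hΦ' one_ne_zero
  refine ⟨q, c.symm, hΦ.to_localInverse hΦ' one_ne_zero, ?_, c.left_inv hd, ?_⟩
  · filter_upwards [c.open_target.mem_nhds (c.map_source hd)] with y hy
    exact congrArg Prod.fst (c.right_inv hy)
  · filter_upwards [c.open_source.mem_nhds hd] with v hv using c.left_inv hv

theorem fderiv_comp_inr_eq_zero_of_eventually_eq_fst [FiniteDimensional 𝕜 F] {P : E → F}
    {L : F →L[𝕜] M} {ψ : M × K → E} {y : M × K} (hP : DifferentiableAt 𝕜 P (ψ y))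
    (hψ : DifferentiableAt 𝕜 ψ y) (hfst : ∀ᶠ y' in 𝓝 y, L (P (ψ y')) = y'.1)
    (hrank : Module.finrank 𝕜 (fderiv 𝕜 P (ψ y)).range = Module.finrank 𝕜 M) :
    fderiv 𝕜 (P ∘ ψ) y ∘L .inr 𝕜 M K = 0 := by
  have hPψ := hP.hasFDerivAt.comp y hψ.hasFDerivAt
  have hfst' : L ∘L fderiv 𝕜 P (ψ y) ∘L fderiv 𝕜 ψ y = .fst 𝕜 M K :=
    ((L.hasFDerivAt.comp y hPψ).congr_of_eventuallyEq (hfst.mono fun _ => Eq.symm)).unique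
      hasFDerivAt_fst
  rw [hPψ.fderiv]
  exact ContinuousLinearMap.coe_injective
    (comp_inr_eq_zero_of_comp_eq_fst (congrArg ContinuousLinearMap.toLinearMap hfst') hrank)

/-- The constant rank theorem: in the local coordinates `(L ∘ P, q)` on its domain, `P` does not
depend on `q`. -/
theorem exists_eventually_eq_comp_of_finrank_eventually_eq [CompleteSpace E]
    [FiniteDimensional 𝕜 F] {P : E → F} {d : E} (hP : ContDiffAt 𝕜 1 P d)
    (hrank : ∀ᶠ v in 𝓝 d,
      Module.finrank 𝕜 (fderiv 𝕜 P v).range = Module.finrank 𝕜 (fderiv 𝕜 P d).range) :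
    ∃ (L : F →L[𝕜] (fderiv 𝕜 P d).range) (g : (fderiv 𝕜 P d).range → F),
      ContDiffAt 𝕜 1 g (L (P d)) ∧ ∀ᶠ v in 𝓝 d, g (L (P v)) = P v := by
  obtain ⟨L, hL⟩ := Submodule.ClosedComplemented.of_finiteDimensional (fderiv 𝕜 P d).range
  have hLP : ContDiffAt 𝕜 1 (L ∘ P) d := L.contDiff.contDiffAt.comp d hP
  have hsurj : Function.Surjective (fderiv 𝕜 (L ∘ P) d) := by
    rw [(L.hasFDerivAt.comp d (hP.differentiableAt one_ne_zero).hasFDerivAt).fderiv]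
    rintro ⟨_, v, rfl⟩
    exact ⟨v, hL ⟨_, v, rfl⟩⟩
  obtain ⟨q, ψ, hψ, hLPψ, hψd, hψLP⟩ := exists_chart_of_surjective_fderiv hLP hsurj
  set y₀ := ((L ∘ P) d, q d)
  have hPψ : ContDiffAt 𝕜 1 (P ∘ ψ) y₀ := (hψd.symm ▸ hP).comp y₀ hψ
  have hvert : ∀ᶠ y in 𝓝 y₀, fderiv 𝕜 (P ∘ ψ) y ∘L .inr 𝕜 _ _ = 0 := by
    have hgood : ∀ᶠ v in 𝓝 (ψ y₀), ContDiffAt 𝕜 1 P v ∧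
        Module.finrank 𝕜 (fderiv 𝕜 P v).range = Module.finrank 𝕜 (fderiv 𝕜 P d).range :=
      hψd.symm ▸ (hP.eventually (by simp)).and hrank
    filter_upwards [hLPψ.eventually_nhds, hψ.eventually (by simp),
      hψ.continuousAt.eventually hgood] with y hfst hψy ⟨hPy, hrank⟩
    exact fderiv_comp_inr_eq_zero_of_eventually_eq_fst (hPy.differentiableAt one_ne_zero)
      (hψy.differentiableAt one_ne_zero) hfst hrank
  have hconst := eventually_eq_of_fderiv_comp_inr_eq_zero
    ((hPψ.eventually (by simp)).mono fun y hy => hy.differentiableAt one_ne_zero) hvert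
  refine ⟨L, fun a => P (ψ (a, q d)), ?_, ?_⟩
  · exact hPψ.comp (L (P d)) (f := fun a => (a, q d)) (contDiff_prodMk_left (q d)).contDiffAt
  · have htendsto : Tendsto (fun v => (L (P v), q v)) (𝓝 d) (𝓝 y₀) :=
      hLP.continuousAt.prodMk_nhds q.continuous.continuousAt
    filter_upwards [hψLP, htendsto.eventually hconst] with v hv hv'
    exact hv'.symm.trans (congrArg P hv)

theorem dimH_image_le_of_finrank_range_fderiv_eq {E F : Type*} [NormedAddCommGroup E]
    [NormedSpace ℂ E] [CompleteSpace E] [SecondCountableTopology E] [NormedAddCommGroup F]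
    [NormedSpace ℂ F] [FiniteDimensional ℂ F] {P : E → F} {D : Set E} {k : ℕ} (hD : IsOpen D)
    (hP : ContDiffOn ℂ 1 P D)
    (hrank : ∀ v ∈ D, Module.finrank ℂ (fderiv ℂ P v).range = k) :
    dimH (P '' D) ≤ (2 * k : ℕ) := by
  have hlocal : ∀ d ∈ D, ∃ N ∈ 𝓝 d, dimH (P '' N) ≤ (2 * k : ℕ) := by
    intro d hd
    obtain ⟨L, g, hg, hgL⟩ := exists_eventually_eq_comp_of_finrank_eventually_eq
      (hP.contDiffAt (hD.mem_nhds hd))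
      (mem_of_superset (hD.mem_nhds hd) fun v hv => (hrank v hv).trans (hrank d hd).symm)
    obtain ⟨C, t, ht, hlip⟩ := hg.exists_lipschitzOnWith
    have hLP : ContinuousAt (fun v => L (P v)) d :=
      L.continuous.continuousAt.comp (hP.continuousOn.continuousAt (hD.mem_nhds hd))
    refine ⟨_, inter_mem hgL (hLP ht), ?_⟩
    calc dimH (P '' _) ≤ dimH (g '' t) := dimH_mono <| Set.image_subset_iff.2 fun v hv =>
          ⟨L (P v), hv.2, hv.1⟩
      _ ≤ dimH t := hlip.dimH_image_le
      _ ≤ dimH Set.univ := dimH_mono (Set.subset_univ t)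
      _ = (2 * k : ℕ) := by rw [Real.dimH_univ_eq_finrank, finrank_real_of_complex, hrank d hd]
  choose! N hN hdim using hlocal
  obtain ⟨t, htD, htc, hcover⟩ := TopologicalSpace.countable_cover_nhdsWithin
    fun d hd => mem_nhdsWithin_of_mem_nhds (hN d hd)
  calc dimH (P '' D) ≤ dimH (P '' ⋃ x ∈ t, N x) := dimH_mono (Set.image_mono hcover)
    _ = ⨆ x ∈ t, dimH (P '' N x) := by rw [Set.image_iUnion₂, dimH_bUnion htc]
    _ ≤ (2 * k : ℕ) := iSup₂_le fun x hx => hdim x (htD hx)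

end ConstantRank

section Germs

variable {G : Type*} [Group G] {n : ℕ} {F : Type} [NormedAddCommGroup F] [NormedSpace ℂ F]

/-- `f` represents the germ at the origin of a holomorphic map, equivariant from `ρ` to `τ`, all of
whose derivatives of order less than `m` vanish. Invariant singularities are the case of trivial `τ`
and `m = 2`; equivariant biholomorphic maps fall under `τ = ρ` and `m = 1`. -/
structure IsEquivariantGerm (ρ : Representation ℂ G (Fin n → ℂ)) (τ : Representation ℂ G F) (m : ℕ)
    (f : (Fin n → ℂ) → F) : Prop where
  analyticAt : AnalyticAt ℂ f 0
  equivariant : ∀ g : G, ∀ᶠ x in 𝓝 (0 : Fin n → ℂ), f (ρ g x) = τ g (f x)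
  iteratedFDeriv_eq_zero : ∀ k < m, iteratedFDeriv ℂ k f 0 = 0

variable {ρ : Representation ℂ G (Fin n → ℂ)} {τ : Representation ℂ G F} {m : ℕ}
  {f : (Fin n → ℂ) → F} {φ : (Fin n → ℂ) → (Fin n → ℂ)}

theorem isInvariantSingularity_iff {f : (Fin n → ℂ) → ℂ} :
    IsInvariantSingularity ρ f ↔ IsEquivariantGerm ρ (Representation.trivial ℂ G ℂ) 2 f := by
  refine ⟨fun h => ⟨h.analyticAt, h.invariant, fun k hk => ?_⟩, fun h =>
    ⟨h.analyticAt, h.equivariant, ?_, ?_⟩⟩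
  · interval_cases k <;> ext v
    · exact h.map_zero
    · simp [h.critical]
  · simpa using DFunLike.congr_fun (h.iteratedFDeriv_eq_zero 0 (by norm_num)) 0
  · ext1 v
    simpa using DFunLike.congr_fun (h.iteratedFDeriv_eq_zero 1 (by norm_num)) fun _ => v

namespace IsEquivariantGerm

theorem map_zero (hf : IsEquivariantGerm ρ τ m f) (hm : 0 < m) : f 0 = 0 := by
  simpa using DFunLike.congr_fun (hf.iteratedFDeriv_eq_zero 0 hm) 0

theorem comp [CompleteSpace F] (hf : IsEquivariantGerm ρ τ m f) (hφ : IsEquivariantGerm ρ ρ 1 φ) :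
    IsEquivariantGerm ρ τ m (f ∘ φ) where
  analyticAt := AnalyticAt.comp ((hφ.map_zero one_pos).symm ▸ hf.analyticAt) hφ.analyticAt
  equivariant g := by
    filter_upwards [hφ.equivariant g, (tendsto_zero hφ.analyticAt
      (hφ.map_zero one_pos)).eventually (hf.equivariant g)] with x hφx hfx
    rw [Function.comp_apply, hφx, hfx, Function.comp_apply]
  iteratedFDeriv_eq_zero k hk := by
    have hjet : jet k f = jet k (0 : (Fin n → ℂ) → F) := funext fun i =>
      (hf.iteratedFDeriv_eq_zero i (by lia)).trans
        (congrFun (iteratedFDeriv_fun_zero (𝕜 := ℂ) (n := i)) 0).symm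
    have hcomp := congrFun (jet_comp_congr k hf.analyticAt analyticAt_const hφ.analyticAt
      hφ.analyticAt (hφ.map_zero one_pos) (hφ.map_zero one_pos) hjet rfl) (Fin.last k)
    exact hcomp.trans (congrFun (iteratedFDeriv_fun_zero (𝕜 := ℂ) (n := k)) 0)

theorem isEquivariantDiffeo (hφ : IsEquivariantGerm ρ ρ 1 φ) (h : (fderiv ℂ φ 0).IsInvertible) :
    IsEquivariantDiffeo ρ φ where
  analyticAt := hφ.analyticAt
  map_zero := hφ.map_zero one_pos
  equivariant := hφ.equivariant
  exists_inverse := by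
    obtain ⟨e, he⟩ := h
    have hderiv : HasFDerivAt φ (e : (Fin n → ℂ) →L[ℂ] (Fin n → ℂ)) 0 :=
      he ▸ hφ.analyticAt.differentiableAt.hasFDerivAt
    have hcont : ContDiffAt ℂ ⊤ φ 0 := hφ.analyticAt.contDiffAt
    let c := hcont.toOpenPartialHomeomorph φ hderiv (by simp)
    have hc : (0 : Fin n → ℂ) ∈ c.source :=
      hcont.mem_toOpenPartialHomeomorph_source hderiv (by simp)
    have hc0 : φ 0 = 0 := hφ.map_zero one_pos
    refine ⟨c.symm, ?_, ?_, ?_, ?_⟩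
    · exact hc0 ▸ (hcont.to_localInverse hderiv (by simp)).analyticAt
    · exact (congrArg c.symm hc0).symm.trans (c.left_inv hc)
    · filter_upwards [c.open_source.mem_nhds hc] with x hx using c.left_inv hx
    · filter_upwards [c.open_target.mem_nhds (hc0 ▸ c.map_source hc)] with x hx
        using c.right_inv hx

end IsEquivariantGerm

theorem isEquivariantDiffeo_iff :
    IsEquivariantDiffeo ρ φ ↔ IsEquivariantGerm ρ ρ 1 φ ∧ (fderiv ℂ φ 0).IsInvertible := by
  refine ⟨fun hφ => ⟨⟨hφ.analyticAt, hφ.equivariant, fun k hk => ?_⟩, ?_⟩,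
    fun h => h.1.isEquivariantDiffeo h.2⟩
  · obtain rfl : k = 0 := by lia
    ext1 _
    exact hφ.map_zero
  · obtain ⟨ψ, hψ, hψ0, hleft, hright⟩ := hφ.exists_inverse
    have hφ' : HasFDerivAt φ (fderiv ℂ φ 0) 0 := hφ.analyticAt.differentiableAt.hasFDerivAt
    have hψ' : HasFDerivAt ψ (fderiv ℂ ψ 0) 0 := hψ.differentiableAt.hasFDerivAt
    have hφψ : HasFDerivAt φ (fderiv ℂ φ 0) (ψ 0) := by rwa [hψ0]
    have hψφ : HasFDerivAt ψ (fderiv ℂ ψ 0) (φ 0) := by rwa [hφ.map_zero]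
    exact .of_inverse
      ((hφψ.comp 0 hψ').unique ((hasFDerivAt_id 0).congr_of_eventuallyEq hright))
      ((hψφ.comp 0 hφ').unique ((hasFDerivAt_id 0).congr_of_eventuallyEq hleft))

end Germs

section PrescribedDerivatives

variable {𝕜 E F : Type*} [RCLike 𝕜] [NormedAddCommGroup E] [NormedSpace 𝕜 E]
  [NormedAddCommGroup F] [NormedSpace 𝕜 F]

/-- The Taylor series at the origin of a function whose `k`-th derivative there is `c k`. -/
noncomputable def seriesOfDerivatives
    (c : (k : ℕ) → ContinuousMultilinearMap 𝕜 (fun _ : Fin k => E) F) :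
    FormalMultilinearSeries 𝕜 E F :=
  fun k => (k.factorial : 𝕜)⁻¹ • c k

variable {c : (k : ℕ) → ContinuousMultilinearMap 𝕜 (fun _ : Fin k => E) F} {C : ℝ}

theorem one_le_radius_seriesOfDerivatives (hC : ∀ k, ‖c k‖ ≤ C) :
    1 ≤ (seriesOfDerivatives c).radius := by
  refine (seriesOfDerivatives c).le_radius_of_bound (r := 1) C fun k => ?_
  have hfact : ‖(k.factorial : 𝕜)⁻¹‖ ≤ 1 := by
    rw [norm_inv, RCLike.norm_natCast]
    exact inv_le_one_of_one_le₀ (by exact_mod_cast k.factorial_pos)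
  calc ‖seriesOfDerivatives c k‖ * ((1 : NNReal) : ℝ) ^ k = ‖(k.factorial : 𝕜)⁻¹‖ * ‖c k‖ := by
        rw [NNReal.coe_one, one_pow, mul_one, seriesOfDerivatives, norm_smul]
    _ ≤ 1 * C := by gcongr; exact hC k
    _ = C := one_mul C

variable [CompleteSpace F]

theorem hasFPowerSeriesOnBall_seriesOfDerivatives (hC : ∀ k, ‖c k‖ ≤ C) :
    HasFPowerSeriesOnBall (seriesOfDerivatives c).sum (seriesOfDerivatives c) 0
      (seriesOfDerivatives c).radius :=
  (seriesOfDerivatives c).hasFPowerSeriesOnBall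
    (zero_lt_one.trans_le (one_le_radius_seriesOfDerivatives hC))

theorem iteratedFDeriv_sum_seriesOfDerivatives (hC : ∀ k, ‖c k‖ ≤ C)
    (hsymm : ∀ k (σ : Equiv.Perm (Fin k)) v, c k (v ∘ σ) = c k v) (k : ℕ) :
    iteratedFDeriv 𝕜 k (seriesOfDerivatives c).sum 0 = c k := by
  ext v
  have hterm : ∀ σ : Equiv.Perm (Fin k),
      seriesOfDerivatives c k (fun i => v (σ i)) = (k.factorial : 𝕜)⁻¹ • c k v :=
    fun σ => congrArg ((k.factorial : 𝕜)⁻¹ • ·) (hsymm k σ v)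
  have hfact : (k.factorial : 𝕜) ≠ 0 := by exact_mod_cast k.factorial_ne_zero
  rw [(hasFPowerSeriesOnBall_seriesOfDerivatives hC).iteratedFDeriv_eq_sum_of_completeSpace,
    Finset.sum_congr rfl fun σ _ => hterm σ, Finset.sum_const, Finset.card_univ,
    Fintype.card_perm, Fintype.card_fin, ← Nat.cast_smul_eq_nsmul 𝕜, smul_inv_smul₀ hfact]

end PrescribedDerivatives

section Forms

variable {G : Type*} [Group G] {n : ℕ} {F : Type} [NormedAddCommGroup F] [NormedSpace ℂ F]

/-- The symmetric `k`-linear maps, equivariant from `ρ` to `τ`, which are the possible `k`-th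
derivatives of equivariant germs vanishing to order `m`; only `0` is possible for `k < m`. -/
def equivariantForms (ρ : Representation ℂ G (Fin n → ℂ)) (τ : Representation ℂ G F) (m k : ℕ) :
    Submodule ℂ (ContinuousMultilinearMap ℂ (fun _ : Fin k => Fin n → ℂ) F) where
  carrier := {c | (∀ (σ : Equiv.Perm (Fin k)) v, c (v ∘ σ) = c v) ∧
    (∀ g v, c (fun i => ρ g (v i)) = τ g (c v)) ∧ (k < m → c = 0)}
  zero_mem' := by simp
  add_mem' {c c'} hc hc' := by
    refine ⟨fun σ v => ?_, fun g v => ?_, fun hk => ?_⟩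
    · simp [hc.1, hc'.1]
    · simp [hc.2.1, hc'.2.1]
    · rw [hc.2.2 hk, hc'.2.2 hk, add_zero]
  smul_mem' t c hc := by
    refine ⟨fun σ v => ?_, fun g v => ?_, fun hk => ?_⟩
    · simp [hc.1]
    · simp [hc.2.1]
    · rw [hc.2.2 hk, smul_zero]

variable {ρ : Representation ℂ G (Fin n → ℂ)} {τ : Representation ℂ G F} {m : ℕ}

theorem IsEquivariantGerm.iteratedFDeriv_mem_equivariantForms [FiniteDimensional ℂ F]
    {f : (Fin n → ℂ) → F} (hf : IsEquivariantGerm ρ τ m f) (k : ℕ) :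
    iteratedFDeriv ℂ k f 0 ∈ equivariantForms ρ τ m k := by
  have : CompleteSpace F := FiniteDimensional.complete ℂ F
  refine ⟨fun σ v => hf.analyticAt.contDiffAt.iteratedFDeriv_comp_perm v σ, fun g v => ?_,
    hf.iteratedFDeriv_eq_zero k⟩
  let e := (LinearEquiv.ofBijective (ρ g) (ρ.apply_bijective g)).toContinuousLinearEquiv
  have hright : iteratedFDeriv ℂ k (f ∘ e) 0 =
      (iteratedFDeriv ℂ k f (e 0)).compContinuousLinearMap fun _ => e := by
    simpa only [Set.preimage_univ, iteratedFDerivWithin_univ] using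
      e.iteratedFDerivWithin_comp_right f uniqueDiffOn_univ (Set.mem_univ (e 0)) k
  have hleft : iteratedFDeriv ℂ k (τ g ∘ f) 0 =
      (τ g).toContinuousLinearMap.compContinuousMultilinearMap (iteratedFDeriv ℂ k f 0) :=
    (τ g).toContinuousLinearMap.iteratedFDeriv_comp_left hf.analyticAt.contDiffAt le_rfl
  have heq := (EventuallyEq.iteratedFDeriv ℂ (hf.equivariant g) k).self_of_nhds
  rw [_root_.map_zero e] at hright
  exact DFunLike.congr_fun (hright.symm.trans (heq.trans hleft)) v

theorem exists_isEquivariantGerm_iteratedFDeriv_eq [FiniteDimensional ℂ F]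
    {c : (k : ℕ) → ContinuousMultilinearMap ℂ (fun _ : Fin k => Fin n → ℂ) F}
    (hc : ∀ k, c k ∈ equivariantForms ρ τ m k) {C : ℝ} (hC : ∀ k, ‖c k‖ ≤ C) :
    ∃ f, IsEquivariantGerm ρ τ m f ∧ ∀ k, iteratedFDeriv ℂ k f 0 = c k := by
  have : CompleteSpace F := FiniteDimensional.complete ℂ F
  have hderiv := iteratedFDeriv_sum_seriesOfDerivatives hC fun k => (hc k).1
  refine ⟨(seriesOfDerivatives c).sum,
    ⟨(hasFPowerSeriesOnBall_seriesOfDerivatives hC).analyticAt, fun g => .of_forall fun x => ?_,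
      fun k hk => (hderiv k).trans ((hc k).2.2 hk)⟩, hderiv⟩
  let e := (LinearEquiv.ofBijective (τ g) (τ.apply_bijective g)).toContinuousLinearEquiv
  calc (seriesOfDerivatives c).sum (ρ g x)
      = ∑' k, e (seriesOfDerivatives c k fun _ => x) := tsum_congr fun k =>
        (congrArg ((k.factorial : ℂ)⁻¹ • ·) ((hc k).2.1 g fun _ => x)).trans (map_smul e _ _).symm
    _ = τ g ((seriesOfDerivatives c).sum x) := e.map_tsum.symm

end Forms

section Jets

instance {𝕜 ι F : Type*} {E : ι → Type*} [NontriviallyNormedField 𝕜] [CompleteSpace 𝕜] [Finite ι]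
    [∀ i, NormedAddCommGroup (E i)] [∀ i, NormedSpace 𝕜 (E i)] [∀ i, FiniteDimensional 𝕜 (E i)]
    [NormedAddCommGroup F] [NormedSpace 𝕜 F] [FiniteDimensional 𝕜 F] :
    FiniteDimensional 𝕜 (ContinuousMultilinearMap 𝕜 E F) :=
  .of_injective (ContinuousMultilinearMap.toMultilinearMapLinear (R' := 𝕜) (A := 𝕜))
    ContinuousMultilinearMap.toMultilinearMap_injective

variable {G : Type*} [Group G] {n : ℕ} {F : Type} [NormedAddCommGroup F] [NormedSpace ℂ F]
  (ρ : Representation ℂ G (Fin n → ℂ)) (τ : Representation ℂ G F) (m r : ℕ)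

/-- The space of `r`-jets of equivariant germs vanishing to order `m`; see `mem_equivariantJets`. -/
noncomputable def equivariantJets : Submodule ℂ (Jet n r F) :=
  Submodule.pi Set.univ fun k => equivariantForms ρ τ m k

noncomputable instance : NormedAddCommGroup (equivariantJets ρ τ m r) :=
  Submodule.normedAddCommGroup _

noncomputable instance : NormedSpace ℂ (equivariantJets ρ τ m r) :=
  Submodule.normedSpace _

instance [FiniteDimensional ℂ F] : FiniteDimensional ℂ (equivariantJets ρ τ m r) :=
  FiniteDimensional.finiteDimensional_submodule (V := Jet n r F) _

/-- The Banach space of bounded sequences of equivariant forms, each of which is the sequence of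
derivatives of an equivariant germ. -/
abbrev EquivariantSeries : Type :=
  lp (fun k => equivariantForms ρ τ m k) ⊤

/-- The `r`-jet of the germ with a given sequence of derivatives. -/
noncomputable def truncation : EquivariantSeries ρ τ m →L[ℂ] equivariantJets ρ τ m r :=
  (ContinuousLinearMap.pi fun k : Fin (r + 1) =>
    (equivariantForms ρ τ m k).subtypeL ∘L lp.evalCLM ℂ _ ⊤ (k : ℕ)).codRestrict _
    fun c k _ => (c k).2

theorem surjective_truncation : Function.Surjective (truncation ρ τ m r) := by
  rintro ⟨j, hj⟩
  let c : (k : ℕ) → equivariantForms ρ τ m k := fun k =>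
    if hk : k < r + 1 then ⟨j ⟨k, hk⟩, hj ⟨k, hk⟩ trivial⟩ else 0
  have hc : Memℓp c ⊤ := by
    refine (memℓp_zero ((Set.finite_lt_nat (r + 1)).subset fun k hk => ?_)).of_exponent_ge le_top
    by_contra hkr
    exact hk (dif_neg hkr)
  refine ⟨⟨c, hc⟩, Subtype.ext (funext fun k => ?_)⟩
  exact congrArg Subtype.val (dif_pos k.2)

variable [FiniteDimensional ℂ F] {ρ τ m r}

theorem exists_isEquivariantGerm_jet_eq (c : EquivariantSeries ρ τ m) :
    ∃ f, IsEquivariantGerm ρ τ m f ∧ ∀ r, jet r f = truncation ρ τ m r c := by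
  obtain ⟨f, hf, hderiv⟩ := exists_isEquivariantGerm_iteratedFDeriv_eq (fun k => (c k).2)
    (lp.norm_apply_le_norm ENNReal.top_ne_zero c)
  exact ⟨f, hf, fun r => funext fun k => hderiv k⟩

theorem mem_equivariantJets {j : Jet n r F} :
    j ∈ equivariantJets ρ τ m r ↔ ∃ f, IsEquivariantGerm ρ τ m f ∧ jet r f = j := by
  constructor
  · intro hj
    obtain ⟨c, hc⟩ := surjective_truncation ρ τ m r ⟨j, hj⟩
    obtain ⟨f, hf, hjet⟩ := exists_isEquivariantGerm_jet_eq c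
    exact ⟨f, hf, (hjet r).trans (congrArg Subtype.val hc)⟩
  · rintro ⟨f, hf, rfl⟩ k -
    exact hf.iteratedFDeriv_mem_equivariantForms k

end Jets

section Composition

variable {n r : ℕ} {F : Type} [NormedAddCommGroup F] [NormedSpace ℂ F]

/-- Composition of jets on the right with the jet `v` of a map preserving the origin, by the formula
of Faà di Bruno; the constant term of `v` plays no part in it. -/
noncomputable def jetPrecomp (v : Jet n r (Fin n → ℂ)) : Jet n r F →L[ℂ] Jet n r F :=
  ContinuousLinearMap.pi fun k => ∑ c : OrderedFinpartition (k : ℕ),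
    ContinuousMultilinearMap.apply ℂ _ _
      (fun i => v ⟨c.partSize i, (c.partSize_le i).trans_lt k.2⟩) ∘L
    c.compAlongOrderedFinpartitionL ℂ (Fin n → ℂ) (Fin n → ℂ) F ∘L
    ContinuousLinearMap.proj (⟨c.length, c.length_le.trans_lt k.2⟩ : Fin (r + 1))

theorem jetPrecomp_apply (v : Jet n r (Fin n → ℂ)) (j : Jet n r F) (k : Fin (r + 1)) :
    jetPrecomp v j k = ∑ c : OrderedFinpartition (k : ℕ),
      c.compAlongOrderedFinpartition (j ⟨c.length, c.length_le.trans_lt k.2⟩)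
        fun i => v ⟨c.partSize i, (c.partSize_le i).trans_lt k.2⟩ := by
  simp [jetPrecomp]

theorem jetPrecomp_jet [CompleteSpace F] {f : (Fin n → ℂ) → F} {φ : (Fin n → ℂ) → (Fin n → ℂ)}
    (hf : AnalyticAt ℂ f 0) (hφ : AnalyticAt ℂ φ 0) (hφ0 : φ 0 = 0) :
    jetPrecomp (jet r φ) (jet r f) = jet r (f ∘ φ) := by
  funext k
  have hfφ : ContDiffAt ℂ (k : ℕ) f (φ 0) := hφ0.symm ▸ hf.contDiffAt
  rw [jetPrecomp_apply]
  change _ = iteratedFDeriv ℂ (k : ℕ) (f ∘ φ) 0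
  rw [iteratedFDeriv_comp hfφ hφ.contDiffAt le_rfl, hφ0]
  rfl

theorem contDiff_jetPrecomp_apply (j : Jet n r F) {m : WithTop ℕ∞} :
    ContDiff ℂ m fun v => jetPrecomp v j := by
  refine contDiff_pi.2 fun k => ?_
  simp only [jetPrecomp_apply]
  refine ContDiff.sum fun c _ => ?_
  exact (c.compAlongOrderedFinpartitionL ℂ (Fin n → ℂ) (Fin n → ℂ) F
    (j ⟨c.length, c.length_le.trans_lt k.2⟩)).contDiff.comp
      (contDiff_pi.2 fun i => contDiff_pi.1 contDiff_id _)

end Composition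

section Action

variable {G : Type*} [Group G] {n : ℕ} {F : Type} [NormedAddCommGroup F] [NormedSpace ℂ F]
  [FiniteDimensional ℂ F] {ρ : Representation ℂ G (Fin n → ℂ)} {τ : Representation ℂ G F} {m r : ℕ}

theorem jetPrecomp_mem_equivariantJets {d : Jet n r (Fin n → ℂ)} (hd : d ∈ equivariantJets ρ ρ 1 r)
    {j : Jet n r F} (hj : j ∈ equivariantJets ρ τ m r) :
    jetPrecomp d j ∈ equivariantJets ρ τ m r := by
  have : CompleteSpace F := FiniteDimensional.complete ℂ F
  obtain ⟨φ, hφ, rfl⟩ := mem_equivariantJets.1 hd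
  obtain ⟨f, hf, rfl⟩ := mem_equivariantJets.1 hj
  exact mem_equivariantJets.2 ⟨f ∘ φ, hf.comp hφ,
    (jetPrecomp_jet hf.analyticAt hφ.analyticAt (hφ.map_zero one_pos)).symm⟩

/-- Composition of jets of equivariant germs on the right with a jet of an equivariant map. -/
noncomputable def rightComp (d : equivariantJets ρ ρ 1 r) :
    equivariantJets ρ τ m r →L[ℂ] equivariantJets ρ τ m r :=
  (jetPrecomp d.1 ∘L Submodule.subtypeL _).codRestrict _
    fun j => jetPrecomp_mem_equivariantJets d.2 j.2

theorem coe_rightComp_of_jet_eq {d : equivariantJets ρ ρ 1 r} {j : equivariantJets ρ τ m r}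
    {φ : (Fin n → ℂ) → (Fin n → ℂ)} {f : (Fin n → ℂ) → F} (hφ : IsEquivariantGerm ρ ρ 1 φ)
    (hf : IsEquivariantGerm ρ τ m f) (hd : jet r φ = d) (hj : jet r f = j) :
    (rightComp d j : Jet n r F) = jet r (f ∘ φ) := by
  have : CompleteSpace F := FiniteDimensional.complete ℂ F
  rw [← jetPrecomp_jet hf.analyticAt hφ.analyticAt (hφ.map_zero one_pos), hd, hj]
  rfl

theorem rightComp_rightComp (d d' : equivariantJets ρ ρ 1 r) (j : equivariantJets ρ τ m r) :
    rightComp d (rightComp d' j) = rightComp (rightComp d d') j := by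
  have : CompleteSpace F := FiniteDimensional.complete ℂ F
  obtain ⟨φ, hφ, hd⟩ := mem_equivariantJets.1 d.2
  obtain ⟨χ, hχ, hd'⟩ := mem_equivariantJets.1 d'.2
  obtain ⟨f, hf, hj⟩ := mem_equivariantJets.1 j.2
  have hχφ := (coe_rightComp_of_jet_eq hφ hχ hd hd').symm
  have hfχ := (coe_rightComp_of_jet_eq hχ hf hd' hj).symm
  exact Subtype.ext ((coe_rightComp_of_jet_eq hφ (hf.comp hχ) hd hfχ).trans
    (coe_rightComp_of_jet_eq (hχ.comp hφ) hf hχφ hj).symm)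

theorem IsEquivariantDiffeo.isEquivariantGerm {φ : (Fin n → ℂ) → (Fin n → ℂ)}
    (hφ : IsEquivariantDiffeo ρ φ) : IsEquivariantGerm ρ ρ 1 φ :=
  (isEquivariantDiffeo_iff.1 hφ).1

variable (ρ r) in
/-- The jet of the identity. -/
noncomputable def idJet : equivariantJets ρ ρ 1 r :=
  ⟨jet r id, mem_equivariantJets.2 ⟨id, IsEquivariantDiffeo.id.isEquivariantGerm, rfl⟩⟩

theorem rightComp_idJet_left (j : equivariantJets ρ τ m r) : rightComp (idJet ρ r) j = j := by
  obtain ⟨f, hf, hj⟩ := mem_equivariantJets.1 j.2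
  exact Subtype.ext ((coe_rightComp_of_jet_eq IsEquivariantDiffeo.id.isEquivariantGerm hf rfl
    hj).trans hj)

theorem rightComp_idJet_right (d : equivariantJets ρ ρ 1 r) : rightComp d (idJet ρ r) = d := by
  obtain ⟨φ, hφ, hd⟩ := mem_equivariantJets.1 d.2
  exact Subtype.ext ((coe_rightComp_of_jet_eq hφ IsEquivariantDiffeo.id.isEquivariantGerm hd
    rfl).trans hd)

variable (ρ r) in
/-- `D^r_G`, as a set of jets of equivariant maps. -/
def diffeoJets : Set (equivariantJets ρ ρ 1 r) :=
  {d | ∃ φ, IsEquivariantDiffeo ρ φ ∧ jet r φ = d}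

theorem mem_diffeoJets (hr : 1 ≤ r) {d : equivariantJets ρ ρ 1 r} :
    d ∈ diffeoJets ρ r ↔ (continuousMultilinearCurryFin1 ℂ (Fin n → ℂ) (Fin n → ℂ)
      (d.1 ⟨1, Nat.lt_succ_of_le hr⟩)).IsInvertible := by
  have hlinear : ∀ {φ}, jet r φ = d → continuousMultilinearCurryFin1 ℂ (Fin n → ℂ) (Fin n → ℂ)
      (d.1 ⟨1, Nat.lt_succ_of_le hr⟩) = fderiv ℂ φ 0 := fun h => by
    rw [← h]
    ext1 v
    simp [jet]
  constructor
  · rintro ⟨φ, hφ, hd⟩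
    exact hlinear hd ▸ (isEquivariantDiffeo_iff.1 hφ).2
  · intro hinv
    obtain ⟨φ, hφ, hd⟩ := mem_equivariantJets.1 d.2
    exact ⟨φ, hφ.isEquivariantDiffeo (hlinear hd ▸ hinv), hd⟩

theorem isOpen_diffeoJets (hr : 1 ≤ r) : IsOpen (diffeoJets ρ r) := by
  have hcont : Continuous fun d : equivariantJets ρ ρ 1 r =>
      continuousMultilinearCurryFin1 ℂ (Fin n → ℂ) (Fin n → ℂ)
        (d.1 ⟨1, Nat.lt_succ_of_le hr⟩) :=
    (LinearIsometryEquiv.continuous _).comp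
      ((continuous_apply _).comp continuous_subtype_val)
  convert ContinuousLinearEquiv.isOpen.preimage hcont using 1
  ext d
  exact mem_diffeoJets hr

theorem exists_rightComp_inverse {d : equivariantJets ρ ρ 1 r} (hd : d ∈ diffeoJets ρ r) :
    ∃ d' : equivariantJets ρ ρ 1 r, rightComp d d' = idJet ρ r ∧ rightComp d' d = idJet ρ r := by
  obtain ⟨φ, hφ, hd⟩ := hd
  obtain ⟨ψ, hψ, hleft, hright⟩ := hφ.exists_inv
  refine ⟨⟨jet r ψ, mem_equivariantJets.2 ⟨ψ, hψ.isEquivariantGerm, rfl⟩⟩, Subtype.ext ?_,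
    Subtype.ext ?_⟩
  · exact (coe_rightComp_of_jet_eq hφ.isEquivariantGerm hψ.isEquivariantGerm hd rfl).trans
      (jet_congr r hleft)
  · exact (coe_rightComp_of_jet_eq hψ.isEquivariantGerm hφ.isEquivariantGerm rfl hd).trans
      (jet_congr r hright)

theorem bijective_rightComp {d : equivariantJets ρ ρ 1 r} (hd : d ∈ diffeoJets ρ r) :
    Function.Bijective (rightComp (τ := τ) (m := m) d) := by
  obtain ⟨d', hdd', hd'd⟩ := exists_rightComp_inverse hd
  refine Function.bijective_iff_has_inverse.2 ⟨rightComp d', fun j => ?_, fun j => ?_⟩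
  · rw [rightComp_rightComp, hd'd, rightComp_idJet_left]
  · rw [rightComp_rightComp, hdd', rightComp_idJet_left]

theorem contDiff_rightComp_apply (j : equivariantJets ρ τ m r) {k : WithTop ℕ∞} :
    ContDiff ℂ k fun v : equivariantJets ρ ρ 1 r => rightComp v j := by
  obtain ⟨P, hP⟩ := (equivariantJets ρ τ m r).subtype.exists_leftInverse_of_injective
    (Submodule.ker_subtype _)
  have hretract : (fun v : equivariantJets ρ ρ 1 r => rightComp v j) =
      fun v => P (jetPrecomp v.1 j.1) :=
    funext fun v => (LinearMap.congr_fun hP (rightComp v j)).symm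
  rw [hretract]
  exact P.toContinuousLinearMap.contDiff.comp
    ((contDiff_jetPrecomp_apply j.1).comp (equivariantJets ρ ρ 1 r).subtypeL.contDiff)

theorem differentiable_rightComp_apply (j : equivariantJets ρ τ m r) :
    Differentiable ℂ fun v : equivariantJets ρ ρ 1 r => rightComp v j :=
  (contDiff_rightComp_apply j).differentiable one_ne_zero

variable (ρ τ m r) in
/-- The derivative at the identity of the orbit map `v ↦ j ∘ v` of `j`, as a function of `j`; its
range is the tangent space to the orbit of `j`. -/
noncomputable def infinitesimalAction :
    equivariantJets ρ τ m r →L[ℂ] equivariantJets ρ ρ 1 r →L[ℂ] equivariantJets ρ τ m r :=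
  LinearMap.toContinuousLinearMap
    { toFun (j : equivariantJets ρ τ m r) :=
        fderiv ℂ (fun v : equivariantJets ρ ρ 1 r => rightComp v j) (idJet ρ r)
      map_add' j j' := by
        simp only [map_add]
        exact fderiv_fun_add (differentiable_rightComp_apply j _)
          (differentiable_rightComp_apply j' _)
      map_smul' t j := by
        simp only [map_smul]
        exact fderiv_fun_const_smul (differentiable_rightComp_apply j _) t }

theorem fderiv_rightComp_apply_comp (j : equivariantJets ρ τ m r) (d : equivariantJets ρ ρ 1 r) :
    fderiv ℂ (fun v : equivariantJets ρ ρ 1 r => rightComp v j) d ∘L rightComp d =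
      rightComp d ∘L infinitesimalAction ρ τ m r j := by
  have hleft := (differentiable_rightComp_apply j (rightComp d (idJet ρ r))).hasFDerivAt.comp _
    (rightComp (τ := ρ) (m := 1) d).hasFDerivAt
  have hright := (rightComp d).hasFDerivAt.comp _
    (differentiable_rightComp_apply j (idJet ρ r)).hasFDerivAt
  rw [rightComp_idJet_right] at hleft
  exact hleft.unique (hright.congr_of_eventuallyEq
    (.of_forall fun v => (rightComp_rightComp d v j).symm))

theorem range_fderiv_rightComp_apply (j : equivariantJets ρ τ m r)
    {d : equivariantJets ρ ρ 1 r} (hd : d ∈ diffeoJets ρ r) :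
    (fderiv ℂ (fun v : equivariantJets ρ ρ 1 r => rightComp v j) d).range =
      (infinitesimalAction ρ τ m r j).range.map
        (rightComp d).toLinearMap := by
  have hsurj : (rightComp (τ := ρ) (m := 1) d).toLinearMap.range = ⊤ :=
    LinearMap.range_eq_top.2 (bijective_rightComp hd).2
  rw [← LinearMap.range_comp_of_range_eq_top _ hsurj, ← LinearMap.range_comp]
  exact congrArg (fun L : equivariantJets ρ ρ 1 r →L[ℂ] equivariantJets ρ τ m r => L.range)
    (fderiv_rightComp_apply_comp j d)

end Action

section Orbits

variable {G : Type*} [Group G] {n : ℕ} {F : Type} [NormedAddCommGroup F] [NormedSpace ℂ F]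
  [FiniteDimensional ℂ F] {ρ : Representation ℂ G (Fin n → ℂ)} {τ : Representation ℂ G F} {m r : ℕ}

/-- The orbit of `j` under `D^r_G`. -/
def diffeoOrbit (j : equivariantJets ρ τ m r) : Set (equivariantJets ρ τ m r) :=
  (fun d : equivariantJets ρ ρ 1 r => rightComp d j) '' diffeoJets ρ r

theorem isOpen_diffeoOrbit (hr : 1 ≤ r) {j : equivariantJets ρ τ m r}
    (hj : Function.Surjective (infinitesimalAction ρ τ m r j)) :
    IsOpen (diffeoOrbit j) := by
  rw [isOpen_iff_mem_nhds]
  rintro _ ⟨d, hd, rfl⟩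
  have hrange : (fderiv ℂ (fun v : equivariantJets ρ ρ 1 r => rightComp v j) d).range = ⊤ := by
    rw [range_fderiv_rightComp_apply j hd, LinearMap.range_eq_top.2 hj, Submodule.map_top]
    exact LinearMap.range_eq_top.2 (bijective_rightComp hd).2
  have hstrict := (contDiff_rightComp_apply j (k := 1)).contDiffAt.hasStrictFDerivAt (x := d)
    one_ne_zero
  have : CompleteSpace (equivariantJets ρ ρ 1 r) := FiniteDimensional.complete ℂ _
  have : CompleteSpace (equivariantJets ρ τ m r) := FiniteDimensional.complete ℂ _
  rw [← hstrict.map_nhds_eq_of_surj hrange]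
  exact image_mem_map ((isOpen_diffeoJets hr).mem_nhds hd)

theorem dimH_diffeoOrbit_le (hr : 1 ≤ r) (j : equivariantJets ρ τ m r) :
    dimH (diffeoOrbit j) ≤
      (2 * Module.finrank ℂ (infinitesimalAction ρ τ m r j).range : ℕ) := by
  have : CompleteSpace (equivariantJets ρ ρ 1 r) := FiniteDimensional.complete ℂ _
  have : ProperSpace (equivariantJets ρ ρ 1 r) := FiniteDimensional.proper ℂ _
  refine dimH_image_le_of_finrank_range_fderiv_eq (isOpen_diffeoJets hr)
    (contDiff_rightComp_apply j).contDiffOn fun d hd => ?_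
  rw [range_fderiv_rightComp_apply j hd]
  exact (LinearEquiv.ofBijective (rightComp d).toLinearMap
    (bijective_rightComp hd)).finrank_map_eq _

theorem exists_surjective_infinitesimalAction (hr : 1 ≤ r) {s U : Set (equivariantJets ρ τ m r)}
    (hs : s.Countable) (hU : (interior U).Nonempty)
    (hUs : U ⊆ ⋃ j ∈ s, diffeoOrbit j) :
    ∃ j ∈ s, Function.Surjective (infinitesimalAction ρ τ m r j) := by
  by_contra! hno
  set N := Module.finrank ℂ (equivariantJets ρ τ m r)
  have hrank : ∀ j ∈ s, Module.finrank ℂ (infinitesimalAction ρ τ m r j).range < N := fun j hj =>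
    Submodule.finrank_lt fun h => hno j hj (LinearMap.range_eq_top.1 h)
  have hN : 0 < N := by
    obtain ⟨u, hu⟩ := hU.mono interior_subset
    obtain ⟨j, hj, -⟩ := Set.mem_iUnion₂.1 (hUs hu)
    exact (Nat.zero_le _).trans_lt (hrank j hj)
  have hdim : dimH U = (2 * N : ℕ) := by
    rw [Real.dimH_of_nonempty_interior hU, finrank_real_of_complex]
  have hle : dimH U ≤ (2 * (N - 1) : ℕ) := by
    refine (dimH_mono hUs).trans ((dimH_bUnion hs _).trans_le (iSup₂_le fun j hj => ?_))
    have := hrank j hj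
    exact (dimH_diffeoOrbit_le hr j).trans (Nat.cast_le.2 (by lia))
  rw [hdim, Nat.cast_le] at hle
  lia

end Orbits

section Singularities

variable {G : Type*} [Group G] {n : ℕ} {ρ : Representation ℂ G (Fin n → ℂ)} {r : ℕ}

variable (ρ r) in
/-- `O^r_G` is homeomorphic to the vector space of jets of invariant germs vanishing to
order two. -/
noncomputable def singularityJetHomeomorph :
    SingularityJet ρ r ≃ₜ equivariantJets ρ (Representation.trivial ℂ G ℂ) 2 r :=
  (Homeomorph.refl (Jet n r ℂ)).subtype fun j => by
    simp only [isInvariantSingularity_iff]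
    exact mem_equivariantJets.symm

theorem singularityJetHomeomorph_smul (j : SingularityJet ρ r) {φ : (Fin n → ℂ) → (Fin n → ℂ)}
    (hφ : IsEquivariantDiffeo ρ φ) {d : equivariantJets ρ ρ 1 r} (hd : jet r φ = d) :
    singularityJetHomeomorph ρ r (MulOpposite.op (DiffeoJet.mk ρ r φ hφ) • j) =
      rightComp d (singularityJetHomeomorph ρ r j) := by
  obtain ⟨_, f, hf, rfl⟩ := j
  refine Subtype.ext ?_
  rw [coe_rightComp_of_jet_eq hφ.isEquivariantGerm (isInvariantSingularity_iff.1 hf) hd rfl]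
  exact congrArg Subtype.val (smul_of ρ r hf hφ)

theorem image_jetOrbit (j : SingularityJet ρ r) :
    singularityJetHomeomorph ρ r '' jetOrbit ρ r j =
      diffeoOrbit (singularityJetHomeomorph ρ r j) := by
  ext x
  constructor
  · rintro ⟨_, ⟨⟨d⟩, rfl⟩, rfl⟩
    obtain ⟨φ, hφ, rfl⟩ := DiffeoJet.exists_mk ρ r d
    exact ⟨⟨jet r φ, mem_equivariantJets.2 ⟨φ, hφ.isEquivariantGerm, rfl⟩⟩, ⟨φ, hφ, rfl⟩,
      (singularityJetHomeomorph_smul j hφ rfl).symm⟩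
  · rintro ⟨d, ⟨φ, hφ, hd⟩, rfl⟩
    exact ⟨_, ⟨MulOpposite.op (DiffeoJet.mk ρ r φ hφ), rfl⟩, singularityJetHomeomorph_smul j hφ hd⟩

theorem isOpen_jetOrbit (hr : 1 ≤ r) {j : SingularityJet ρ r}
    (hj : Function.Surjective
      (infinitesimalAction ρ _ 2 r (singularityJetHomeomorph ρ r j))) :
    IsOpen (jetOrbit ρ r j) := by
  rw [← (singularityJetHomeomorph ρ r).isOpen_image, image_jetOrbit]
  exact isOpen_diffeoOrbit hr hj

theorem exists_surjective_infinitesimalAction_of_countable_image_jetOrbit (hr : 1 ≤ r)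
    {j : SingularityJet ρ r} {U : Set (SingularityJet ρ r)} (hU : U ∈ 𝓝 j)
    (hcount : (jetOrbit ρ r '' U).Countable) :
    ∃ x, Function.Surjective
      (infinitesimalAction ρ (Representation.trivial ℂ G ℂ) 2 r x) := by
  let h := singularityJetHomeomorph ρ r
  obtain ⟨t, -, ht⟩ := Set.exists_subset_bijOn U (jetOrbit ρ r)
  have htcount : t.Countable :=
    Set.countable_of_injective_of_countable_image ht.injOn (ht.image_eq ▸ hcount)
  have hcover : h '' U ⊆ ⋃ x ∈ h '' t, diffeoOrbit x := by
    rintro _ ⟨u, hu, rfl⟩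
    obtain ⟨i, hi, hiu⟩ := ht.surjOn ⟨u, hu, rfl⟩
    refine Set.mem_iUnion₂.2 ⟨h i, ⟨i, hi, rfl⟩, ?_⟩
    rw [← image_jetOrbit, hiu]
    exact ⟨u, MulAction.mem_orbit_self u, rfl⟩
  obtain ⟨x, -, hx⟩ := exists_surjective_infinitesimalAction hr (htcount.image h)
    ⟨h j, mem_interior_iff_mem_nhds.2 (h.isOpenMap.image_mem_nhds hU)⟩ hcover
  exact ⟨x, hx⟩

end Singularities

section Existence

variable {G : Type*} [Group G] {n : ℕ} {ρ : Representation ℂ G (Fin n → ℂ)}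

variable {F : Type} [NormedAddCommGroup F] [NormedSpace ℂ F] [FiniteDimensional ℂ F]
  {τ : Representation ℂ G F} {m : ℕ} in
theorem exists_isEquivariantGerm_surjective_infinitesimalAction {S : Set ℕ}
    (hS : ∀ r ∈ S, ∃ x, Function.Surjective (infinitesimalAction ρ τ m r x)) :
    ∃ f, IsEquivariantGerm ρ τ m f ∧ ∀ r ∈ S, ∀ j : equivariantJets ρ τ m r, jet r f = j →
      Function.Surjective (infinitesimalAction ρ τ m r j) := by
  have : CompleteSpace F := FiniteDimensional.complete ℂ F
  have hlift (r : S) : ∃ c, Function.Surjective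
      ((infinitesimalAction ρ τ m r ∘L truncation ρ τ m r) c) := by
    obtain ⟨x, hx⟩ := hS r r.2
    obtain ⟨c, rfl⟩ := surjective_truncation ρ τ m r x
    exact ⟨c, hx⟩
  obtain ⟨c, hc⟩ := exists_forall_surjective (V := fun r : S => equivariantJets ρ ρ 1 r)
    (W := fun r : S => equivariantJets ρ τ m r)
    (fun r => infinitesimalAction ρ τ m r ∘L truncation ρ τ m r) hlift
  obtain ⟨f, hf, hjet⟩ := exists_isEquivariantGerm_jet_eq c
  refine ⟨f, hf, fun r hr j hj => ?_⟩
  obtain rfl : truncation ρ τ m r c = j := Subtype.ext ((hjet r).symm.trans hj)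
  exact hc ⟨r, hr⟩

theorem IsEquivariantlySimple.exists_isEquivariantlyStable {f : (Fin n → ℂ) → ℂ}
    (hf : IsEquivariantlySimple ρ f) : ∃ f', IsEquivariantlyStable ρ f' := by
  obtain ⟨_, N, hN⟩ := hf
  have hevent : ∀ᶠ r in atTop, 1 ≤ r ∧ ∃ x, Function.Surjective
      (infinitesimalAction ρ (Representation.trivial ℂ G ℂ) 2 r x) := by
    filter_upwards [hN, eventually_ge_atTop 1] with r ⟨U, hU, hcard⟩ hr
    exact ⟨hr, exists_surjective_infinitesimalAction_of_countable_image_jetOrbit hr hU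
      (Set.finite_of_encard_le_coe hcard).countable⟩
  obtain ⟨R, hR⟩ := eventually_atTop.1 hevent
  obtain ⟨f', hf', hsurj⟩ := exists_isEquivariantGerm_surjective_infinitesimalAction
    (S := Set.Ici R) fun r hr => (hR r hr).2
  refine ⟨f', isInvariantSingularity_iff.2 hf', ?_⟩
  filter_upwards [eventually_ge_atTop R] with r hr
  exact isOpen_jetOrbit (hR r hr).1 (hsurj r hr _ rfl)

theorem IsEquivariantlyStable.isEquivariantlySimple {f : (Fin n → ℂ) → ℂ}
    (hf : IsEquivariantlyStable ρ f) : IsEquivariantlySimple ρ f := by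
  obtain ⟨hf, hopen⟩ := hf
  refine ⟨hf, 1, ?_⟩
  filter_upwards [hopen] with r hr
  refine ⟨_, hr.mem_nhds (MulAction.mem_orbit_self _), ?_⟩
  rw [Nat.cast_one, Set.encard_le_one_iff]
  rintro _ _ ⟨a, ha, rfl⟩ ⟨b, hb, rfl⟩
  exact (MulAction.orbit_eq_iff.2 ha).trans (MulAction.orbit_eq_iff.2 hb).symm

end Existence

end EquivariantSingularity

theorem theorem3_general {G : Type*} [Group G] {n : ℕ} (ρ : Representation ℂ G (Fin n → ℂ)) :
    (∃ f : (Fin n → ℂ) → ℂ, EquivariantSingularity.IsEquivariantlySimple ρ f) ↔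
      ∃ f : (Fin n → ℂ) → ℂ, EquivariantSingularity.IsEquivariantlyStable ρ f :=
  ⟨fun ⟨_, hf⟩ => hf.exists_isEquivariantlyStable, fun ⟨f, hf⟩ => ⟨f, hf.isEquivariantlySimple⟩⟩

theorem theorem3 {G : Type*} [Group G] [Finite G] {n : ℕ}
    (ρ : Representation ℂ G (Fin n → ℂ)) :
    (∃ f : (Fin n → ℂ) → ℂ, EquivariantSingularity.IsEquivariantlySimple ρ f) ↔
      ∃ f : (Fin n → ℂ) → ℂ, EquivariantSingularity.IsEquivariantlyStable ρ f :=
  theorem3_general ρ
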